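/- Let $(\Omega,\mu)$ be a measure space with $\mu(\Omega)=\infty$ that is non-atomic, i.e. every measurable set $A$ with $\mu(A)>0$ has a measurable subset $B$ with $0<\mu(B)<\mu(A)$. An exponent is a measurable function $p:\Omega\to[1,\infty)$ (possibly unbounded). The variable Lebesgue space $L^{p(\cdot)}(\mu)$ consists of all ($\mu$-a.e. classes of) real measurable functions $f$ on $\Omega$ such that $\rho_{p(\cdot)}(f/r)<\infty$ for some $r>0$, where $$\rho_{p(\cdot)}(f)=\int_\Omega |f(t)|^{p(t)}\,d\mu(t),$$ and it carries the Luxemburg norm $\|f\|_{p(\cdot)}=\inf\{r>0:\rho_{p(\cdot)}(f/r)\le 1\}$. A bounded linear operator $T$ from $L^{p(\cdot)}(\mu)$ to a normed space is disjointly strictly singular if there is no sequence $(f_n)$ in $L^{p(\cdot)}(\mu)$ with $\|f_n\|_{p(\cdot)}=1$ for all $n$ and $f_mf_n=0$ a.e. for all $m\ne n$ such that the restriction of $T$ to the closed linear span $[f_n]$ is an isomorphism onto its image. Theorem. Let $p(\cdot)$ and $q(\cdot)$ be exponents on $\Omega$ such that $L^{p(\cdot)}(\mu)\subseteq L^{q(\cdot)}(\mu)$.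 Then the inclusion map $L^{p(\cdot)}(\mu)\hookrightarrow L^{q(\cdot)}(\mu)$ is a bounded linear operator, and it is not disjointly strictly singular. -/

import Mathlib

open MeasureTheory
open scoped ENNReal

noncomputable section

/-- A measure is non-atomic if every measurable set of positive measure has a measurable subset
of strictly smaller positive measure.  (In particular a set of infinite measure contains sets of
finite positive measure, so that there are no atoms of infinite measure either.) -/
def NonAtomic {Ω : Type*} [MeasurableSpace Ω] (μ : Measure Ω) : Prop :=
  ∀ A : Set Ω, MeasurableSet A → 0 < μ A →
    ∃ B : Set Ω, B ⊆ A ∧ MeasurableSet B ∧ 0 < μ B ∧ μ B < μ A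

/-- An exponent function: a real measurable function `p` on `Ω` with `1 ≤ p t < ∞`.
It may be unbounded. -/
structure VarExponent (Ω : Type*) [MeasurableSpace Ω] where
  /-- the underlying function -/
  toFun : Ω → ℝ
  /-- it is measurable -/
  measurable_toFun : Measurable toFun
  /-- its values are at least one -/
  one_le_toFun : ∀ t, 1 ≤ toFun t

variable {Ω : Type*} [MeasurableSpace Ω]

/-- The modular `ρ_p(f) = ∫ |f(t)|^{p(t)} dμ`, with values in `[0, ∞]`. -/
def varModular (p : VarExponent Ω) (μ : Measure Ω) (f : Ω → ℝ) : ℝ≥0∞ :=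
  ∫⁻ t, ENNReal.ofReal (|f t| ^ p.toFun t) ∂μ

/-- The Luxemburg functional `inf {r > 0 : ρ_p(f / r) ≤ 1}`. -/
def luxemburg (p : VarExponent Ω) (μ : Measure Ω) (f : Ω → ℝ) : ℝ :=
  sInf {r : ℝ | 0 < r ∧ varModular p μ (fun t => f t / r) ≤ 1}

section Lemmas

variable {p : VarExponent Ω} {μ : Measure Ω} {f g : Ω → ℝ}

theorem varModular_congr (h : f =ᵐ[μ] g) : varModular p μ f = varModular p μ g := by
  apply lintegral_congr_ae
  filter_upwards [h] with t ht
  simp only [ht]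

theorem luxemburg_congr (h : f =ᵐ[μ] g) : luxemburg p μ f = luxemburg p μ g := by
  unfold luxemburg
  congr 1
  ext r
  have : varModular p μ (fun t => f t / r) = varModular p μ (fun t => g t / r) := by
    apply varModular_congr
    filter_upwards [h] with t ht
    simp only [ht]
  simp only [Set.mem_ofPred_eq, this]

theorem varModular_zero : varModular p μ (fun _ => 0) = 0 := by
  have h : ∀ t, ENNReal.ofReal (|(0 : ℝ)| ^ p.toFun t) = 0 := fun t => by
    have := p.one_le_toFun t
    rw [abs_zero, Real.zero_rpow (by linarith), ENNReal.ofReal_zero]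
  simp only [varModular, h, lintegral_zero]

theorem varModular_neg : varModular p μ (fun t => -f t) = varModular p μ f := by
  simp only [varModular, abs_neg]

theorem luxemburg_nonneg : 0 ≤ luxemburg p μ f :=
  Real.sInf_nonneg fun _ hr => hr.1.le

theorem luxemburg_le {r : ℝ} (hr : 0 < r) (h : varModular p μ (fun t => f t / r) ≤ 1) :
    luxemburg p μ f ≤ r :=
  csInf_le ⟨0, fun _ hs => hs.1.le⟩ ⟨hr, h⟩

theorem varModular_mul_le {s : ℝ} (h0 : 0 ≤ s) (h1 : s ≤ 1) :
    varModular p μ (fun t => s * f t) ≤ ENNReal.ofReal s * varModular p μ f := by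
  unfold varModular
  rw [← lintegral_const_mul' _ _ ENNReal.ofReal_ne_top]
  apply lintegral_mono
  intro t
  have hp := p.one_le_toFun t
  dsimp only
  rw [← ENNReal.ofReal_mul h0, abs_mul, abs_of_nonneg h0, Real.mul_rpow h0 (abs_nonneg _)]
  apply ENNReal.ofReal_le_ofReal
  apply mul_le_mul_of_nonneg_right _ (by positivity)
  calc s ^ p.toFun t ≤ s ^ (1 : ℝ) := Real.rpow_le_rpow_of_exponent_ge_of_imp h0 h1 hp (by
        intro _ h; linarith)
    _ = s := Real.rpow_one s

theorem varModular_add_le (hf : AEMeasurable f μ) {a b : ℝ} (ha : 0 < a) (hb : 0 < b) :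
    varModular p μ (fun t => (f t + g t) / (a + b)) ≤
      ENNReal.ofReal (a / (a + b)) * varModular p μ (fun t => f t / a) +
        ENNReal.ofReal (b / (a + b)) * varModular p μ (fun t => g t / b) := by
  unfold varModular
  have hm : AEMeasurable (fun t => ENNReal.ofReal (|f t / a| ^ p.toFun t)) μ := by
    have := p.measurable_toFun
    exact ((continuous_abs.measurable.comp_aemeasurable (hf.div_const a)).pow
      this.aemeasurable).ennreal_ofReal
  rw [← lintegral_const_mul' _ _ ENNReal.ofReal_ne_top,
    ← lintegral_const_mul' _ _ ENNReal.ofReal_ne_top,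
    ← lintegral_add_left' (hm.const_mul _)]
  apply lintegral_mono
  intro t
  have hp := p.one_le_toFun t
  have ha' : 0 ≤ a / (a + b) := by positivity
  have hb' : 0 ≤ b / (a + b) := by positivity
  have hab : a / (a + b) + b / (a + b) = 1 := by field_simp
  dsimp only
  rw [← ENNReal.ofReal_mul ha', ← ENNReal.ofReal_mul hb',
    ← ENNReal.ofReal_add (by positivity) (by positivity)]
  apply ENNReal.ofReal_le_ofReal
  have hle : |(f t + g t) / (a + b)| ≤ a / (a + b) * |f t / a| + b / (a + b) * |g t / b| := by
    have : (f t + g t) / (a + b) = a / (a + b) * (f t / a) + b / (a + b) * (g t / b) := by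
      field_simp
    rw [this]
    refine (abs_add_le _ _).trans ?_
    rw [abs_mul, abs_mul, abs_of_nonneg ha', abs_of_nonneg hb']
  refine (Real.rpow_le_rpow (abs_nonneg _) hle (by linarith)).trans ?_
  exact (convexOn_rpow hp).2 (Set.mem_Ici.2 (abs_nonneg _)) (Set.mem_Ici.2 (abs_nonneg _))
    ha' hb' hab

theorem luxemburg_set_nonempty (h : ∃ r : ℝ, 0 < r ∧ varModular p μ (fun t => f t / r) < ∞) :
    {r : ℝ | 0 < r ∧ varModular p μ (fun t => f t / r) ≤ 1}.Nonempty := by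
  obtain ⟨r, hr, hfin⟩ := h
  set M := varModular p μ (fun t => f t / r) with hM
  set s : ℝ := max 1 M.toReal with hs
  have hs1 : 1 ≤ s := le_max_left _ _
  have hs0 : 0 < s := by linarith
  refine ⟨s * r, by positivity, ?_⟩
  have he : (fun t => f t / (s * r)) = fun t => s⁻¹ * (f t / r) := by
    ext t; field_simp
  rw [he]
  refine (varModular_mul_le (by positivity) (inv_le_one_of_one_le₀ hs1)).trans ?_
  rw [← hM, ← ENNReal.ofReal_toReal hfin.ne, ← ENNReal.ofReal_mul (by positivity),
    ENNReal.ofReal_le_one, inv_mul_le_iff₀ hs0, mul_one]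
  exact le_max_right _ _

end Lemmas

/-- The variable Lebesgue (Nakano) space `L^{p(·)}(μ)`: the space of all classes, modulo equality
almost everywhere, of real measurable functions `f` with `ρ_p(f / r) < ∞` for some `r > 0`. -/
def VarLp (p : VarExponent Ω) (μ : Measure Ω) : Submodule ℝ (Ω →ₘ[μ] ℝ) where
  carrier := {f | ∃ r : ℝ, 0 < r ∧ varModular p μ (fun t => f t / r) < ∞}
  zero_mem' := by
    refine ⟨1, one_pos, ?_⟩
    have : varModular p μ (fun t => (0 : Ω →ₘ[μ] ℝ) t / 1) = 0 := by
      rw [← varModular_zero (p := p) (μ := μ)]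
      apply varModular_congr
      filter_upwards [AEEqFun.coeFn_zero (μ := μ) (β := ℝ)] with t ht
      simp [ht]
    rw [this]
    exact ENNReal.zero_lt_top
  add_mem' := by
    rintro f g ⟨a, ha, hfa⟩ ⟨b, hb, hgb⟩
    refine ⟨a + b, by positivity, ?_⟩
    have : varModular p μ (fun t => (f + g : Ω →ₘ[μ] ℝ) t / (a + b)) =
        varModular p μ (fun t => (f t + g t) / (a + b)) := by
      apply varModular_congr
      filter_upwards [AEEqFun.coeFn_add f g] with t ht
      simp [ht]
    rw [this]
    refine (varModular_add_le f.aemeasurable ha hb).trans_lt ?_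
    exact ENNReal.add_lt_top.2 ⟨ENNReal.mul_lt_top ENNReal.ofReal_lt_top hfa,
      ENNReal.mul_lt_top ENNReal.ofReal_lt_top hgb⟩
  smul_mem' := by
    rintro c f ⟨r, hr, hf⟩
    have hc : 0 < |c| + 1 := by positivity
    refine ⟨(|c| + 1) * r, by positivity, ?_⟩
    have : varModular p μ (fun t => (c • f : Ω →ₘ[μ] ℝ) t / ((|c| + 1) * r)) =
        varModular p μ (fun t => |c| / (|c| + 1) * (f t / r)) := by
      unfold varModular
      apply lintegral_congr_ae
      filter_upwards [AEEqFun.coeFn_smul c f] with t ht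
      rw [ht, Pi.smul_apply, smul_eq_mul, div_mul_div_comm, abs_div, abs_div, abs_mul c, abs_mul |c|,
        abs_abs c]
    rw [this]
    refine (varModular_mul_le (by positivity) ?_).trans_lt ?_
    · rw [div_le_one hc]; linarith
    · exact ENNReal.mul_lt_top ENNReal.ofReal_lt_top hf

/-- `L^{p(·)}(μ)` is normed by the Luxemburg norm. -/
def VarLp.addGroupNorm (p : VarExponent Ω) (μ : Measure Ω) : AddGroupNorm (VarLp p μ) where
  toFun f := luxemburg p μ (f : Ω →ₘ[μ] ℝ)
  map_zero' := by
    refine le_antisymm ?_ luxemburg_nonneg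
    apply le_of_forall_pos_le_add
    intro ε hε
    rw [zero_add]
    apply luxemburg_le hε
    have : varModular p μ (fun t => ((0 : VarLp p μ) : Ω →ₘ[μ] ℝ) t / ε) = 0 := by
      rw [← varModular_zero (p := p) (μ := μ)]
      apply varModular_congr
      filter_upwards [AEEqFun.coeFn_zero (μ := μ) (β := ℝ)] with t ht
      simp [ht]
    rw [this]
    exact zero_le_one
  add_le' := by
    intro f g
    have hne : ∀ f : VarLp p μ, _ := fun f => luxemburg_set_nonempty f.2
    apply le_of_forall_pos_le_add
    intro ε hε
    obtain ⟨a, ⟨ha, hfa⟩, hla⟩ := exists_lt_of_csInf_lt (hne f)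
      (lt_add_of_pos_right (luxemburg p μ (f : Ω →ₘ[μ] ℝ)) (half_pos hε))
    obtain ⟨b, ⟨hb, hgb⟩, hlb⟩ := exists_lt_of_csInf_lt (hne g)
      (lt_add_of_pos_right (luxemburg p μ (g : Ω →ₘ[μ] ℝ)) (half_pos hε))
    have key : luxemburg p μ ((f + g : VarLp p μ) : Ω →ₘ[μ] ℝ) ≤ a + b := by
      have h : ((f + g : VarLp p μ) : Ω →ₘ[μ] ℝ) =ᵐ[μ]
          fun t => (f : Ω →ₘ[μ] ℝ) t + (g : Ω →ₘ[μ] ℝ) t :=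
        AEEqFun.coeFn_add (f : Ω →ₘ[μ] ℝ) g
      rw [luxemburg_congr h]
      apply luxemburg_le (by positivity)
      refine (varModular_add_le (f : Ω →ₘ[μ] ℝ).aemeasurable ha hb).trans ?_
      calc _ ≤ ENNReal.ofReal (a / (a + b)) * 1 + ENNReal.ofReal (b / (a + b)) * 1 := by gcongr
        _ = 1 := by
          rw [mul_one, mul_one, ← ENNReal.ofReal_add (by positivity) (by positivity),
            ← add_div, div_self (by positivity), ENNReal.ofReal_one]
    linarith
  neg' := by
    intro f
    have h : ((-f : VarLp p μ) : Ω →ₘ[μ] ℝ) =ᵐ[μ] fun t => -(f : Ω →ₘ[μ] ℝ) t :=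
      AEEqFun.coeFn_neg (f : Ω →ₘ[μ] ℝ)
    rw [luxemburg_congr h]
    simp only [luxemburg, neg_div, varModular_neg]
  eq_zero_of_map_eq_zero' := by
    intro f hf
    have hsmall : ∀ ε : ℝ, 0 < ε → varModular p μ (f : Ω →ₘ[μ] ℝ) ≤ ENNReal.ofReal ε := by
      intro ε hε
      have hlt : luxemburg p μ (f : Ω →ₘ[μ] ℝ) < min ε 1 := by
        rw [hf]; exact lt_min hε one_pos
      obtain ⟨r, ⟨hr, hfr⟩, hlr⟩ := exists_lt_of_csInf_lt (luxemburg_set_nonempty f.2) hlt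
      have he : ((f : Ω →ₘ[μ] ℝ) : Ω → ℝ) = fun t => r * ((f : Ω →ₘ[μ] ℝ) t / r) := by
        ext t; field_simp
      rw [he]
      calc _ ≤ ENNReal.ofReal r * varModular p μ (fun t => (f : Ω →ₘ[μ] ℝ) t / r) :=
            varModular_mul_le hr.le (hlr.le.trans (min_le_right _ _))
        _ ≤ ENNReal.ofReal r * 1 := by gcongr
        _ ≤ ENNReal.ofReal ε := by
          rw [mul_one]
          exact ENNReal.ofReal_le_ofReal (hlr.le.trans (min_le_left _ _))
    have h0 : varModular p μ (f : Ω →ₘ[μ] ℝ) = 0 := by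
      refine le_antisymm (ENNReal.le_of_forall_pos_le_add ?_) bot_le
      intro ε hε _
      rw [zero_add]
      simpa using hsmall ε (by exact_mod_cast hε)
    unfold varModular at h0
    have hm : AEMeasurable
        (fun t => ENNReal.ofReal (|(f : Ω →ₘ[μ] ℝ) t| ^ p.toFun t)) μ :=
      ((continuous_abs.measurable.comp_aemeasurable (f : Ω →ₘ[μ] ℝ).aemeasurable).pow
        p.measurable_toFun.aemeasurable).ennreal_ofReal
    rw [lintegral_eq_zero_iff' hm] at h0
    apply Subtype.ext
    apply AEEqFun.ext
    filter_upwards [h0, AEEqFun.coeFn_zero (μ := μ) (β := ℝ)] with t ht h0t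
    have hp := p.one_le_toFun t
    change (f : Ω →ₘ[μ] ℝ) t = (0 : Ω →ₘ[μ] ℝ) t
    rw [h0t]
    simp only [Pi.zero_apply, ENNReal.ofReal_eq_zero] at ht ⊢
    by_contra hne
    have : 0 < |(f : Ω →ₘ[μ] ℝ) t| ^ p.toFun t := Real.rpow_pos_of_pos (abs_pos.2 hne) _
    linarith

instance VarLp.instNormedAddCommGroup (p : VarExponent Ω) (μ : Measure Ω) :
    NormedAddCommGroup (VarLp p μ) :=
  AddGroupNorm.toNormedAddCommGroup (VarLp.addGroupNorm p μ)

theorem VarLp.norm_def {p : VarExponent Ω} {μ : Measure Ω} (f : VarLp p μ) :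
    ‖f‖ = sInf {r : ℝ | 0 < r ∧ varModular p μ (fun t => (f : Ω →ₘ[μ] ℝ) t / r) ≤ 1} :=
  rfl

instance VarLp.instNormedSpace (p : VarExponent Ω) (μ : Measure Ω) :
    NormedSpace ℝ (VarLp p μ) where
  norm_smul_le := by
    intro c f
    rcases eq_or_ne c 0 with rfl | hc
    · simp
    · have hc' : 0 < |c| := abs_pos.2 hc
      rw [Real.norm_eq_abs, ← div_le_iff₀' hc']
      refine le_csInf (luxemburg_set_nonempty f.2) ?_
      rintro r ⟨hr, hfr⟩
      rw [div_le_iff₀' hc']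
      change luxemburg p μ ((c • f : VarLp p μ) : Ω →ₘ[μ] ℝ) ≤ _
      apply luxemburg_le (by positivity)
      refine le_trans (le_of_eq ?_) hfr
      unfold varModular
      apply lintegral_congr_ae
      filter_upwards [AEEqFun.coeFn_smul c (f : Ω →ₘ[μ] ℝ)] with t ht
      have : ((c • f : VarLp p μ) : Ω →ₘ[μ] ℝ) t = c * (f : Ω →ₘ[μ] ℝ) t := ht
      rw [this, abs_div, abs_mul, abs_mul, abs_abs, mul_div_mul_left _ _ hc'.ne', ← abs_div]

/-- A bounded linear operator `T` on `L^{p(·)}(μ)` is disjointly strictly singular if there is no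
normalized sequence `(f n)` of pairwise disjoint (that is, disjointly supported) elements of
`L^{p(·)}(μ)` such that the restriction of `T` to the closed linear span `[f n]` is an isomorphism
onto its image. -/
def DisjointlyStrictlySingular {p : VarExponent Ω} {μ : Measure Ω} {F : Type*}
    [NormedAddCommGroup F] [NormedSpace ℝ F] (T : VarLp p μ →L[ℝ] F) : Prop :=
  ¬ ∃ f : ℕ → VarLp p μ,
    (∀ n, ‖f n‖ = 1) ∧
    (∀ m n, m ≠ n → ∀ᵐ t ∂μ, (f m : Ω →ₘ[μ] ℝ) t = 0 ∨ (f n : Ω →ₘ[μ] ℝ) t = 0) ∧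
    Topology.IsEmbedding
      (fun x : (Submodule.span ℝ (Set.range f)).topologicalClosure => T (x : VarLp p μ))

end

open MeasureTheory
open scoped ENNReal

/-! ### Monotonicity of the Luxemburg functional and boundedness of the inclusion. -/

section Luxemburg

variable {Ω : Type*} [MeasurableSpace Ω] {p q : VarExponent Ω} {μ : Measure Ω} {f g : Ω → ℝ}

/-! The inclusion is bounded by a gliding-hump argument (`VarLp.exists_inclusion_bound`). Testing
the bound on tall indicators of small sets, which non-atomicity supplies, gives `q ≤ p` a.e.
(`NonAtomic.ae_le_of_varLp_le`). Non-atomicity together with `μ univ = ∞` also gives disjoint sets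
`A n` of finite measure at least 2. A function that is constant on each `A n`, zero elsewhere and of
`q`-modular at most one satisfies `|f| ≤ 1`, hence `|f|^p ≤ |f|^q`. So the `p`-norm is at most the
`q`-norm on such functions (`luxemburg_le_of_mem_stepSubmodule`), and the inclusion is bounded below
on the closed span of the normalized indicators of the `A n`. -/

theorem varModular_mono (h : ∀ᵐ t ∂μ, |f t| ≤ |g t|) : varModular p μ f ≤ varModular p μ g := by
  apply lintegral_mono_ae
  filter_upwards [h] with t ht
  exact ENNReal.ofReal_le_ofReal
    (Real.rpow_le_rpow (abs_nonneg _) ht (zero_le_one.trans (p.one_le_toFun t)))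

/-- The strict inequality avoids having to know that the infimum is attained. -/
theorem varModular_div_le_one_of_luxemburg_lt
    (hf : ∃ r : ℝ, 0 < r ∧ varModular p μ (fun t => f t / r) < ∞) {s : ℝ}
    (hs : luxemburg p μ f < s) : varModular p μ (fun t => f t / s) ≤ 1 := by
  obtain ⟨r, ⟨hr, hfr⟩, hrs⟩ := exists_lt_of_csInf_lt (luxemburg_set_nonempty hf) hs
  refine (varModular_mono (Filter.Eventually.of_forall fun t => ?_)).trans hfr
  rw [abs_div, abs_div, abs_of_pos hr, abs_of_pos (hr.trans hrs)]
  exact div_le_div_of_nonneg_left (abs_nonneg _) hr hrs.le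

theorem luxemburg_mono (hg : ∃ r : ℝ, 0 < r ∧ varModular p μ (fun t => g t / r) < ∞)
    (h : ∀ᵐ t ∂μ, |f t| ≤ |g t|) : luxemburg p μ f ≤ luxemburg p μ g := by
  refine csInf_le_csInf ⟨0, fun _ hs => hs.1.le⟩ (luxemburg_set_nonempty hg) ?_
  rintro r ⟨hr, hgr⟩
  refine ⟨hr, (varModular_mono ?_).trans hgr⟩
  filter_upwards [h] with t ht
  rw [abs_div, abs_div]
  gcongr

theorem aemeasurable_varModular_integrand (hf : AEMeasurable f μ) :
    AEMeasurable (fun t => ENNReal.ofReal (|f t| ^ p.toFun t)) μ :=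
  ((continuous_abs.measurable.comp_aemeasurable hf).pow
    p.measurable_toFun.aemeasurable).ennreal_ofReal

/-- A sequence with summable modulars is dominated by a single function of finite modular. -/
theorem exists_dominating_of_tsum_varModular_lt_top {h : ℕ → Ω → ℝ}
    (hm : ∀ n, AEMeasurable (h n) μ) (hsum : ∑' n, varModular p μ (h n) < ∞) :
    ∃ g : Ω → ℝ, AEMeasurable g μ ∧ varModular p μ g < ∞ ∧
      ∀ n, ∀ᵐ t ∂μ, |h n t| ≤ |g t| := by
  set S : Ω → ℝ≥0∞ := fun t => ∑' n, ENNReal.ofReal (|h n t| ^ p.toFun t) with hS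
  have hSm : AEMeasurable S μ :=
    AEMeasurable.tsum fun n => aemeasurable_varModular_integrand (hm n)
  have hSint : ∫⁻ t, S t ∂μ < ∞ := by
    rw [hS, lintegral_tsum fun n => aemeasurable_varModular_integrand (hm n)]
    exact hsum
  have hfin : ∀ᵐ t ∂μ, S t < ∞ := ae_lt_top' hSm hSint.ne
  have hpow : ∀ t, |(S t).toReal ^ (p.toFun t)⁻¹| ^ p.toFun t = (S t).toReal := fun t => by
    have := p.one_le_toFun t
    rw [abs_of_nonneg (by positivity), Real.rpow_inv_rpow ENNReal.toReal_nonneg (by linarith)]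
  -- The dominating function is `(∑ |h n|^p)^(1/p)`. Where the sum is infinite `toReal` gives 0, but
  -- this happens only on a null set.
  refine ⟨fun t => (S t).toReal ^ (p.toFun t)⁻¹,
    hSm.ennreal_toReal.pow p.measurable_toFun.inv.aemeasurable, ?_, fun n => ?_⟩
  · refine lt_of_le_of_lt (lintegral_mono fun t => ?_) hSint
    dsimp only
    rw [hpow]
    exact ENNReal.ofReal_toReal_le
  · filter_upwards [hfin] with t ht
    have hp := p.one_le_toFun t
    rw [← Real.rpow_le_rpow_iff (abs_nonneg _) (abs_nonneg _) (by linarith : 0 < p.toFun t), hpow]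
    exact (ENNReal.ofReal_le_iff_le_toReal ht.ne).1
      (ENNReal.le_tsum (f := fun n => ENNReal.ofReal (|h n t| ^ p.toFun t)) n)

theorem mk_mem_varLp (hf : AEMeasurable f μ) {r : ℝ} (hr : 0 < r)
    (h : varModular p μ (fun t => f t / r) < ∞) :
    AEEqFun.mk f hf.aestronglyMeasurable ∈ VarLp p μ := by
  refine ⟨r, hr, ?_⟩
  rw [varModular_congr (g := fun t => f t / r)]
  · exact h
  · filter_upwards [AEEqFun.coeFn_mk f hf.aestronglyMeasurable] with t ht
    rw [ht]

/-- An inclusion between variable Lebesgue spaces is automatically bounded. -/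
theorem VarLp.exists_inclusion_bound (hincl : VarLp p μ ≤ VarLp q μ) :
    ∃ C : ℝ, 0 < C ∧ ∀ f : VarLp p μ, ‖Submodule.inclusion hincl f‖ ≤ C * ‖f‖ := by
  by_contra! hcon
  choose f hf using fun n : ℕ => hcon (4 ^ n) (by positivity)
  have hf0 : ∀ n, 0 < ‖f n‖ := fun n => by
    rw [norm_pos_iff]
    intro h0
    have := hf n
    rw [h0, map_zero, norm_zero, norm_zero, mul_zero] at this
    exact lt_irrefl _ this
  -- The factor 2 puts `f n / (2‖f n‖)` strictly inside the unit ball, so its modular is at most 1.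
  -- Of the growth `4 ^ n`, one factor `2 ^ n` pays for summability and the other contradicts the
  -- finiteness of the `q`-norm of a common dominating function.
  set h : ℕ → Ω → ℝ := fun n t => (1 / 2) ^ n * ((f n : Ω →ₘ[μ] ℝ) t / (2 * ‖f n‖)) with hh
  have hm : ∀ n, AEMeasurable (h n) μ := fun n =>
    ((f n : Ω →ₘ[μ] ℝ).aemeasurable.div_const _).const_mul _
  have hle : ∀ n, varModular p μ (h n) ≤ ENNReal.ofReal ((1 / 2) ^ n) := fun n =>
    calc varModular p μ (h n) ≤ ENNReal.ofReal ((1 / 2) ^ n) *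
          varModular p μ (fun t => (f n : Ω →ₘ[μ] ℝ) t / (2 * ‖f n‖)) :=
          varModular_mul_le (by positivity) (pow_le_one₀ (by norm_num) (by norm_num))
      _ ≤ ENNReal.ofReal ((1 / 2) ^ n) * 1 := by
          gcongr
          apply varModular_div_le_one_of_luxemburg_lt (f n).2
          change ‖f n‖ < 2 * ‖f n‖
          linarith [hf0 n]
      _ = _ := mul_one _
  obtain ⟨g, hgm, hgfin, hg⟩ := exists_dominating_of_tsum_varModular_lt_top (p := p) hm
    ((ENNReal.tsum_le_tsum hle).trans_lt (by
      rw [← ENNReal.ofReal_tsum_of_nonneg (fun n => by positivity) summable_geometric_two]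
      exact ENNReal.ofReal_lt_top))
  have hgq := hincl (mk_mem_varLp (p := p) hgm one_pos (by simpa only [div_one] using hgfin))
  set G : VarLp q μ := ⟨_, hgq⟩ with hG
  have key : ∀ n : ℕ, (2 : ℝ) ^ n < 2 * ‖G‖ := by
    intro n
    have h1 : ‖Submodule.inclusion hincl (f n)‖ ≤ ‖((2 : ℝ) ^ n * (2 * ‖f n‖)) • G‖ := by
      apply luxemburg_mono (((2 : ℝ) ^ n * (2 * ‖f n‖)) • G).2
      filter_upwards [hg n, AEEqFun.coeFn_mk g hgm.aestronglyMeasurable,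
        AEEqFun.coeFn_smul ((2 : ℝ) ^ n * (2 * ‖f n‖)) (G : Ω →ₘ[μ] ℝ)] with t ht hmk hsm
      have e : ((((2 : ℝ) ^ n * (2 * ‖f n‖)) • G : VarLp q μ) : Ω →ₘ[μ] ℝ) t =
          (2 : ℝ) ^ n * (2 * ‖f n‖) * g t := by
        rw [← hmk]; exact hsm
      rw [e]
      have e2 : ((Submodule.inclusion hincl (f n) : VarLp q μ) : Ω →ₘ[μ] ℝ) t =
          (2 : ℝ) ^ n * (2 * ‖f n‖) * h n t := by
        have := (hf0 n).ne'
        simp only [hh, Submodule.coe_inclusion, one_div, inv_pow]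
        field_simp
      rw [e2, abs_mul, abs_mul _ (g t)]
      gcongr
    rw [norm_smul, Real.norm_of_nonneg (by positivity)] at h1
    have h2 := (hf n).trans_le h1
    have h4 : (4 : ℝ) ^ n = 2 ^ n * 2 ^ n := by rw [← mul_pow]; norm_num
    have h3 : (2 : ℝ) ^ n * ‖f n‖ * 2 ^ n < (2 : ℝ) ^ n * ‖f n‖ * (2 * ‖G‖) := by
      rw [h4] at h2; linarith
    exact lt_of_mul_lt_mul_left h3 (by positivity)
  obtain ⟨n, hn⟩ := pow_unbounded_of_one_lt (2 * ‖G‖) (one_lt_two (α := ℝ))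
  exact lt_asymm hn (key n)

end Luxemburg

/-! ### Small sets, large finite sets and disjoint sequences in a non-atomic measure space. -/

section NonAtomic

variable {Ω : Type*} [MeasurableSpace Ω] {μ : Measure Ω}

/-- Either the subset `B` given by non-atomicity or its complement in `A` has at most half the
measure; the second case forces `μ A` to be finite. -/
theorem NonAtomic.exists_subset_measure_le_half (hμ : NonAtomic μ) {A : Set Ω}
    (hA : MeasurableSet A) (h0 : 0 < μ A) :
    ∃ B ⊆ A, MeasurableSet B ∧ 0 < μ B ∧ μ B < ∞ ∧ μ B ≤ μ A / 2 := by
  obtain ⟨B, hBA, hB, hB0, hlt⟩ := hμ A hA h0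
  have hBtop : μ B < ∞ := hlt.trans_le le_top
  rcases le_total (μ B) (μ A / 2) with h | h
  · exact ⟨B, hBA, hB, hB0, hBtop, h⟩
  · have hd : μ (A \ B) = μ A - μ B := measure_sdiff hBA hB.nullMeasurableSet hBtop.ne
    have hAtop : μ A ≠ ∞ := by
      rintro hA'
      rw [hA', ENNReal.top_div_of_ne_top (by norm_num)] at h
      exact absurd hBtop (not_lt.2 h)
    refine ⟨A \ B, Set.sdiff_subset, hA.diff hB, ?_, ?_, ?_⟩
    · rw [hd]; exact tsub_pos_of_lt hlt
    · exact (measure_mono Set.sdiff_subset).trans_lt hAtop.lt_top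
    · rw [hd, tsub_le_iff_right]
      calc μ A = μ A / 2 + μ A / 2 := (ENNReal.add_halves _).symm
        _ ≤ μ A / 2 + μ B := by gcongr

theorem NonAtomic.exists_subset_measure_lt (hμ : NonAtomic μ) {A : Set Ω}
    (hA : MeasurableSet A) (h0 : 0 < μ A) {ε : ℝ≥0∞} (hε : 0 < ε) :
    ∃ B ⊆ A, MeasurableSet B ∧ 0 < μ B ∧ μ B < ε := by
  -- Repeated halving tends to zero only from a finite measure, so it starts at `A₀` rather than at
  -- `A`.
  obtain ⟨A₀, hA₀A, hA₀, hA₀0, hA₀top, -⟩ := hμ.exists_subset_measure_le_half hA h0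
  have key : ∀ n : ℕ, ∃ B ⊆ A, MeasurableSet B ∧ 0 < μ B ∧ μ B ≤ μ A₀ * 2⁻¹ ^ n := by
    intro n
    induction n with
    | zero => exact ⟨A₀, hA₀A, hA₀, hA₀0, by simp⟩
    | succ n ih =>
      obtain ⟨B, hBA, hB, hB0, hle⟩ := ih
      obtain ⟨C, hCB, hC, hC0, -, hle'⟩ := hμ.exists_subset_measure_le_half hB hB0
      refine ⟨C, hCB.trans hBA, hC, hC0, hle'.trans ?_⟩
      rw [pow_succ, ← mul_assoc, div_eq_mul_inv]
      gcongr
  have ht : Filter.Tendsto (fun n : ℕ => μ A₀ * 2⁻¹ ^ n) Filter.atTop (nhds (μ A₀ * 0)) :=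
    ENNReal.Tendsto.const_mul
      (ENNReal.tendsto_pow_atTop_nhds_zero_of_lt_one (by simp)) (Or.inr hA₀top.ne)
  rw [mul_zero] at ht
  obtain ⟨n, hn⟩ := (ht.eventually (gt_mem_nhds hε)).exists
  obtain ⟨B, hBA, hB, hB0, hle⟩ := key n
  exact ⟨B, hBA, hB, hB0, hle.trans_lt hn⟩

/-- A non-atomic measure is semifinite: sets of infinite measure contain sets of arbitrarily large
finite measure. -/
theorem NonAtomic.exists_subset_finite_measure_ge (hμ : NonAtomic μ) {A : Set Ω}
    (hA : MeasurableSet A) (htop : μ A = ∞) {c : ℝ≥0∞} (hc : c ≠ ∞) :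
    ∃ B ⊆ A, MeasurableSet B ∧ c ≤ μ B ∧ μ B < ∞ := by
  by_contra! hcon
  have hlt : ∀ B ⊆ A, MeasurableSet B → μ B < ∞ → μ B < c := fun B hBA hB hfin => by
    by_contra! h
    exact absurd hfin (not_lt.2 (hcon B hBA hB h))
  -- Exhaustion: a countable union realizes the supremum of the finite measures of subsets of `A`.
  -- The bound `c` keeps that union of finite measure, so its remainder in `A` is infinite and
  -- contains a further piece of finite positive measure, exceeding the supremum.
  let V : Set ℝ≥0∞ := {v | ∃ B ⊆ A, MeasurableSet B ∧ μ B < ∞ ∧ μ B = v}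
  have hVne : V.Nonempty := ⟨0, ∅, Set.empty_subset _, MeasurableSet.empty, by simp, by simp⟩
  obtain ⟨u, -, hu, huV⟩ := exists_seq_tendsto_sSup hVne (OrderTop.bddAbove V)
  choose B hBA hB hBfin hBu using huV
  let U : ℕ → Set Ω := Set.accumulate B
  have hUA : ∀ n, U n ⊆ A := fun n => Set.iUnion₂_subset fun k _ => hBA k
  have hUm : ∀ n, MeasurableSet (U n) := fun n => (Set.finite_le_nat n).measurableSet_biUnion fun k _ => hB k
  have hUfin : ∀ n, μ (U n) < ∞ := fun n => by
    refine (measure_biUnion_lt_top (Set.finite_le_nat n) fun k _ => ?_)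
    exact hBfin k
  have hWA : ⋃ n, B n ⊆ A := Set.iUnion_subset hBA
  have hWm : MeasurableSet (⋃ n, B n) := MeasurableSet.iUnion hB
  have hWc : μ (⋃ n, B n) ≤ c := by
    have := tendsto_measure_iUnion_accumulate (μ := μ) (f := B)
    exact le_of_tendsto' this fun n => (hlt _ (hUA n) (hUm n) (hUfin n)).le
  have hWfin : μ (⋃ n, B n) < ∞ := hWc.trans_lt hc.lt_top
  have hsup : sSup V ≤ μ (⋃ n, B n) :=
    le_of_tendsto' hu fun n => by
      rw [← hBu n]; exact measure_mono (Set.subset_iUnion B n)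
  have hrest : μ (A \ ⋃ n, B n) = ∞ := by
    rw [measure_sdiff hWA hWm.nullMeasurableSet hWfin.ne, htop, ENNReal.top_sub hWfin.ne]
  obtain ⟨D, hDA, hD, hD0, hDlt⟩ := hμ _ (hA.diff hWm) (by rw [hrest]; exact ENNReal.zero_lt_top)
  have hDfin : μ D < ∞ := hDlt.trans_le le_top
  have hun : μ ((⋃ n, B n) ∪ D) = μ (⋃ n, B n) + μ D :=
    measure_union (Set.disjoint_left.2 fun t h1 h2 => (hDA h2).2 h1) hD
  have hmem : μ ((⋃ n, B n) ∪ D) ≤ sSup V :=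
    le_sSup ⟨_, Set.union_subset hWA (hDA.trans Set.sdiff_subset), hWm.union hD,
      by rw [hun]; exact ENNReal.add_lt_top.2 ⟨hWfin, hDfin⟩, rfl⟩
  rw [hun] at hmem
  exact absurd (hmem.trans hsup) (not_le.2 (ENNReal.lt_add_right hWfin.ne hD0.ne'))

/-- Finitely many sets of finite measure leave a complement of infinite measure, from which the next
set is taken. -/
theorem NonAtomic.exists_pairwise_disjoint_seq (hμ : NonAtomic μ) (hinf : μ Set.univ = ∞)
    {c : ℝ≥0∞} (hc : c ≠ ∞) :
    ∃ A : ℕ → Set Ω, (∀ n, MeasurableSet (A n) ∧ c ≤ μ (A n) ∧ μ (A n) < ∞) ∧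
      Pairwise fun m n => Disjoint (A m) (A n) := by
  have : Std.Symm (fun s t : Set Ω => Disjoint s t) := ⟨fun _ _ h => h.symm⟩
  refine exists_seq_of_forall_finset_exists'
    (fun B : Set Ω => MeasurableSet B ∧ c ≤ μ B ∧ μ B < ∞) (fun s t => Disjoint s t) ?_
  intro s hs
  have hm : MeasurableSet (⋃ B ∈ s, B) := s.measurableSet_biUnion fun B hB => (hs B hB).1
  have hfin : μ (⋃ B ∈ s, B) < ∞ :=
    measure_biUnion_lt_top s.finite_toSet fun B hB => (hs B hB).2.2
  have htop : μ (⋃ B ∈ s, B)ᶜ = ∞ := by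
    rw [measure_compl hm hfin.ne, hinf, ENNReal.top_sub hfin.ne]
  obtain ⟨B, hBs, hB, hcB, hBfin⟩ := hμ.exists_subset_finite_measure_ge hm.compl htop hc
  exact ⟨B, ⟨hB, hcB, hBfin⟩, fun x hx => Set.disjoint_left.2 fun t htx htB =>
    hBs htB (Set.mem_biUnion (by exact hx) htx)⟩

end NonAtomic

/-! ### Comparison of the exponents, and of the norms on step functions. -/

section Comparison

variable {Ω : Type*} [MeasurableSpace Ω] {p q : VarExponent Ω} {μ : Measure Ω}

theorem varModular_indicator_const (p : VarExponent Ω) {B : Set Ω} (hB : MeasurableSet B)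
    (s : ℝ) :
    varModular p μ (B.indicator fun _ => s) =
      ∫⁻ t in B, ENNReal.ofReal (|s| ^ p.toFun t) ∂μ := by
  rw [← lintegral_indicator hB]
  refine lintegral_congr fun t => ?_
  by_cases ht : t ∈ B
  · simp [ht]
  · have := p.one_le_toFun t
    simp [ht, Real.zero_rpow (by linarith : p.toFun t ≠ 0)]

theorem indicator_const_div {α : Type*} (B : Set α) (s r : ℝ) :
    (fun t => B.indicator (fun _ => s) t / r) = B.indicator fun _ => s / r := by
  ext t
  by_cases ht : t ∈ B <;> simp [ht]

/-- On a non-atomic space, an inclusion `L^p ⊆ L^q` forces `q ≤ p`. -/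
theorem NonAtomic.ae_le_of_varLp_le (hμ : NonAtomic μ) (hincl : VarLp p μ ≤ VarLp q μ) :
    ∀ᵐ t ∂μ, q.toFun t ≤ p.toFun t := by
  obtain ⟨C, hC, hbound⟩ := VarLp.exists_inclusion_bound hincl
  -- Rational `a < b` strictly between `p` and `q` reduce the claim to countably many null sets,
  -- with a uniform gap `b - a` on each.
  suffices h : ∀ a b : ℚ, a < b → ∀ᵐ t ∂μ, ¬ (p.toFun t < a ∧ (b : ℝ) < q.toFun t) by
    have h' : ∀ᵐ t ∂μ, ∀ a b : ℚ, a < b → ¬ (p.toFun t < a ∧ (b : ℝ) < q.toFun t) := by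
      simp only [ae_all_iff]
      exact h
    filter_upwards [h'] with t ht
    by_contra! hlt
    obtain ⟨a, hpa, haq⟩ := exists_rat_btwn hlt
    obtain ⟨b, hab, hbq⟩ := exists_rat_btwn haq
    exact ht a b (by exact_mod_cast hab) ⟨hpa, hbq⟩
  intro a b hab
  have hab' : (a : ℝ) < b := by exact_mod_cast hab
  set E : Set Ω := {t | p.toFun t < a ∧ (b : ℝ) < q.toFun t} with hE
  have hEm : MeasurableSet E := (measurableSet_lt p.measurable_toFun measurable_const).inter
    (measurableSet_lt measurable_const q.measurable_toFun)
  rw [ae_iff]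
  simp only [not_not]
  change μ E = 0
  by_contra hE0
  have hEpos : 0 < μ E := pos_iff_ne_zero.2 hE0
  obtain ⟨t₀, ht₀⟩ := nonempty_of_measure_ne_zero hE0
  have ha : 0 < (a : ℝ) := by linarith [p.one_le_toFun t₀, ht₀.1]
  have hb : 0 < (b : ℝ) := ha.trans hab'
  -- Any number above `C` would do: the `q`-norm of the test function is at most `C`, so dividing by
  -- `D` brings its `q`-modular down to at most 1.
  set D : ℝ := 2 * C with hD
  have hDpos : 0 < D := by positivity
  have hev : ∀ᶠ s : ℝ in Filter.atTop, 1 ≤ s ∧ D ≤ s ∧ D ^ (b : ℝ) < s ^ ((b : ℝ) - a) :=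
    (Filter.eventually_ge_atTop 1).and ((Filter.eventually_ge_atTop D).and
      ((tendsto_rpow_atTop (sub_pos.2 hab')).eventually_gt_atTop _))
  obtain ⟨s₀, hs₀⟩ := Filter.eventually_atTop.1 hev
  set s₁ : ℝ := max s₀ 1 with hs₁
  have hs₁1 : 1 ≤ s₁ := le_max_right _ _
  have hs₁0 : 0 < s₁ := by linarith
  obtain ⟨B, hBE, hB, hB0, hBlt⟩ := hμ.exists_subset_measure_lt hEm hEpos
    (ε := ENNReal.ofReal (s₁ ^ (-(a : ℝ)))) (ENNReal.ofReal_pos.2 (by positivity))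
  set δ : ℝ := (μ B).toReal with hδ
  have hBtop : μ B ≠ ∞ := (hBlt.trans ENNReal.ofReal_lt_top).ne
  have hδ0 : 0 < δ := ENNReal.toReal_pos hB0.ne' hBtop
  have hδμ : μ B = ENNReal.ofReal δ := (ENNReal.ofReal_toReal hBtop).symm
  have hδlt : δ < s₁ ^ (-(a : ℝ)) := by
    rw [hδμ] at hBlt
    exact (ENNReal.ofReal_lt_ofReal_iff (by positivity)).1 hBlt
  -- The height is normalized by `s ^ a * μ B = 1`, which makes the `p`-modular of `s · 1_B` at most
  -- 1. The `q`-modular of `(s / D) · 1_B` is at least `(s / D) ^ b * δ = s ^ (b - a) / D ^ b`,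
  -- which exceeds 1 because `μ B` was chosen small enough to force `s` large.
  set s : ℝ := δ ^ (-(a : ℝ)⁻¹) with hs
  have hspos : 0 < s := by positivity
  have hsa : s ^ (a : ℝ) = δ⁻¹ := by
    rw [hs, ← Real.rpow_mul hδ0.le, neg_mul, inv_mul_cancel₀ ha.ne', Real.rpow_neg_one]
  have hss₁ : s₁ ≤ s := by
    rw [← Real.rpow_le_rpow_iff hs₁0.le hspos.le ha, hsa, le_inv_comm₀ (by positivity) hδ0,
      ← Real.rpow_neg hs₁0.le]
    exact hδlt.le
  obtain ⟨hs1, hsD, hsb⟩ := hs₀ s ((le_max_left _ _).trans hss₁)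
  have hmod : varModular p μ (B.indicator fun _ => s) ≤ 1 := by
    rw [varModular_indicator_const p hB]
    calc ∫⁻ t in B, ENNReal.ofReal (|s| ^ p.toFun t) ∂μ
        ≤ ∫⁻ _ in B, ENNReal.ofReal (s ^ (a : ℝ)) ∂μ := by
          refine setLIntegral_mono measurable_const fun t ht => ENNReal.ofReal_le_ofReal ?_
          rw [abs_of_pos hspos]
          exact Real.rpow_le_rpow_of_exponent_le hs1 (hBE ht).1.le
      _ = 1 := by
          rw [setLIntegral_const, hδμ, ← ENNReal.ofReal_mul (by positivity), hsa,
            inv_mul_cancel₀ hδ0.ne', ENNReal.ofReal_one]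
  have hmeas : AEMeasurable (B.indicator fun _ => s) μ :=
    (measurable_const.indicator hB).aemeasurable
  have hmem := mk_mem_varLp (p := p) hmeas one_pos
    (by simpa only [div_one] using hmod.trans_lt ENNReal.one_lt_top)
  set F : VarLp p μ := ⟨_, hmem⟩ with hF
  have hFae : (F : Ω →ₘ[μ] ℝ) =ᵐ[μ] B.indicator fun _ => s :=
    AEEqFun.coeFn_mk _ hmeas.aestronglyMeasurable
  have hFnorm : ‖F‖ ≤ 1 := by
    change luxemburg p μ (F : Ω →ₘ[μ] ℝ) ≤ 1
    rw [luxemburg_congr hFae]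
    exact luxemburg_le one_pos (by simpa only [div_one] using hmod)
  have hlt : luxemburg q μ (F : Ω →ₘ[μ] ℝ) < D := by
    have h1 : luxemburg q μ (F : Ω →ₘ[μ] ℝ) ≤ C * ‖F‖ := hbound F
    have h2 : C * ‖F‖ ≤ C * 1 := by gcongr
    linarith
  have hq := varModular_div_le_one_of_luxemburg_lt (hincl F.2) hlt
  rw [varModular_congr (g := B.indicator fun _ => s / D) (by
      filter_upwards [hFae] with t ht
      rw [ht, ← indicator_const_div]), varModular_indicator_const q hB] at hq
  refine absurd hq (not_le.2 ?_)
  have hsD1 : 1 ≤ s / D := (one_le_div hDpos).2 hsD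
  calc (1 : ℝ≥0∞) < ENNReal.ofReal ((s / D) ^ (b : ℝ) * δ) := by
        rw [ENNReal.one_lt_ofReal, Real.div_rpow hspos.le hDpos.le, div_mul_eq_mul_div,
          one_lt_div (by positivity)]
        have : s ^ (b : ℝ) * δ = s ^ ((b : ℝ) - a) := by
          rw [Real.rpow_sub hspos, hsa, div_inv_eq_mul]
        rw [this]
        exact hsb
    _ = ∫⁻ _ in B, ENNReal.ofReal ((s / D) ^ (b : ℝ)) ∂μ := by
        rw [setLIntegral_const, hδμ, ← ENNReal.ofReal_mul (by positivity)]
    _ ≤ _ := by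
        refine setLIntegral_mono' hB fun t ht => ENNReal.ofReal_le_ofReal ?_
        rw [abs_of_pos (by positivity)]
        exact Real.rpow_le_rpow_of_exponent_le hsD1 (hBE ht).2.le

/-- The functions that are a.e. constant on each `A n` and vanish a.e. off their union. -/
def stepSubmodule (μ : Measure Ω) (A : ℕ → Set Ω) : Submodule ℝ (Ω →ₘ[μ] ℝ) where
  carrier := {f | ∃ c : ℕ → ℝ, ∀ᵐ t ∂μ, (∀ n, t ∈ A n → f t = c n) ∧ ((∀ n, t ∉ A n) → f t = 0)}
  zero_mem' := by
    refine ⟨0, ?_⟩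
    filter_upwards [AEEqFun.coeFn_zero (μ := μ) (β := ℝ)] with t ht
    simp [ht]
  add_mem' := by
    rintro f g ⟨c, hc⟩ ⟨d, hd⟩
    refine ⟨c + d, ?_⟩
    filter_upwards [AEEqFun.coeFn_add f g, hc, hd] with t ht hct hdt
    rw [ht]
    exact ⟨fun n hn => by simp [hct.1 n hn, hdt.1 n hn], fun hn => by simp [hct.2 hn, hdt.2 hn]⟩
  smul_mem' := by
    rintro a f ⟨c, hc⟩
    refine ⟨a • c, ?_⟩
    filter_upwards [AEEqFun.coeFn_smul a f, hc] with t ht hct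
    rw [ht]
    exact ⟨fun n hn => by simp [hct.1 n hn], fun hn => by simp [hct.2 hn]⟩

/-- If `q ≤ p`, then the `p`-norm is dominated by the `q`-norm on functions that are constant
on sets of measure at least two: such a function of `q`-modular at most one is bounded by one. -/
theorem luxemburg_le_of_mem_stepSubmodule (hqp : ∀ᵐ t ∂μ, q.toFun t ≤ p.toFun t) {A : ℕ → Set Ω}
    (hA : ∀ n, MeasurableSet (A n)) (hA2 : ∀ n, 2 ≤ μ (A n)) {f : Ω →ₘ[μ] ℝ}
    (hf : f ∈ stepSubmodule μ A) (hfq : f ∈ VarLp q μ) : luxemburg p μ f ≤ luxemburg q μ f := by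
  refine csInf_le_csInf ⟨0, fun _ hs => hs.1.le⟩ (luxemburg_set_nonempty hfq) ?_
  rintro r ⟨hr, hfr⟩
  refine ⟨hr, le_trans (lintegral_mono_ae ?_) hfr⟩
  obtain ⟨c, hc⟩ := hf
  -- A value above 1 on `A n` would already give modular at least `μ (A n) ≥ 2`.
  have hc1 : ∀ n, |c n / r| ≤ 1 := by
    intro n
    by_contra! hlt
    have : (2 : ℝ≥0∞) ≤ 1 :=
      calc (2 : ℝ≥0∞) ≤ μ (A n) := hA2 n
        _ = ∫⁻ _ in A n, 1 ∂μ := by rw [setLIntegral_one]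
        _ ≤ ∫⁻ t in A n, ENNReal.ofReal (|f t / r| ^ q.toFun t) ∂μ := by
          refine setLIntegral_mono_ae' (hA n) ?_
          filter_upwards [hc] with t ht htA
          rw [ht.1 n htA, ENNReal.one_le_ofReal]
          exact Real.one_le_rpow hlt.le (zero_le_one.trans (q.one_le_toFun t))
        _ ≤ varModular q μ (fun t => f t / r) := setLIntegral_le_lintegral _ _
        _ ≤ 1 := hfr
    norm_num at this
  filter_upwards [hc, hqp] with t ht hqpt
  have hle : |f t / r| ≤ 1 := by
    by_cases h : ∃ n, t ∈ A n
    · obtain ⟨n, hn⟩ := h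
      rw [ht.1 n hn]
      exact hc1 n
    · push Not at h
      simp [ht.2 h]
  apply ENNReal.ofReal_le_ofReal
  exact Real.rpow_le_rpow_of_exponent_ge_of_imp (abs_nonneg _) hle hqpt
    fun _ h0 => by linarith [q.one_le_toFun t]

theorem indicator_one_mem_varLp (p : VarExponent Ω) {B : Set Ω} (hB : MeasurableSet B)
    (hfin : μ B < ∞) :
    AEEqFun.mk (B.indicator fun _ => (1 : ℝ))
      (measurable_const.indicator hB).aestronglyMeasurable ∈ VarLp p μ := by
  refine mk_mem_varLp (measurable_const.indicator hB).aemeasurable one_pos ?_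
  simp only [div_one]
  rw [varModular_indicator_const p hB]
  simpa using hfin

end Comparison

/-! ### Normalized disjoint indicators on whose closed span the inclusion is an isomorphism. -/

theorem theorem6p3 {Ω : Type*} [MeasurableSpace Ω] (μ : Measure Ω)
    (hμ : NonAtomic μ) (hinf : μ Set.univ = ∞) (p q : VarExponent Ω)
    (hincl : VarLp p μ ≤ VarLp q μ) :
    ∃ i : VarLp p μ →L[ℝ] VarLp q μ,
      (∀ f : VarLp p μ, (i f : Ω →ₘ[μ] ℝ) = (f : Ω →ₘ[μ] ℝ)) ∧
        ¬ DisjointlyStrictlySingular i := by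
  obtain ⟨C, -, hbound⟩ := VarLp.exists_inclusion_bound hincl
  set i : VarLp p μ →L[ℝ] VarLp q μ :=
    (Submodule.inclusion hincl).mkContinuous C hbound with hi
  have hcoe : ∀ f : VarLp p μ, (i f : Ω →ₘ[μ] ℝ) = (f : Ω →ₘ[μ] ℝ) := fun _ => rfl
  refine ⟨i, hcoe, not_not.2 ?_⟩
  have hqp := hμ.ae_le_of_varLp_le hincl
  obtain ⟨A, hA, hdisj⟩ := hμ.exists_pairwise_disjoint_seq hinf (c := 2) (by norm_num)
  let e : ℕ → VarLp p μ := fun n => ⟨_, indicator_one_mem_varLp p (hA n).1 (hA n).2.2⟩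
  have heae : ∀ n, (e n : Ω →ₘ[μ] ℝ) =ᵐ[μ] (A n).indicator fun _ => (1 : ℝ) := fun n =>
    AEEqFun.coeFn_mk _ (measurable_const.indicator (hA n).1).aestronglyMeasurable
  have he0 : ∀ n, e n ≠ 0 := by
    intro n h0
    have hz : ∀ᵐ t ∂μ, t ∉ A n := by
      filter_upwards [heae n, AEEqFun.coeFn_zero (μ := μ) (β := ℝ)] with t ht h0t htA
      have h1 : ((0 : VarLp p μ) : Ω →ₘ[μ] ℝ) t = 1 := by rw [← h0, ht]; simp [htA]
      have h2 : ((0 : VarLp p μ) : Ω →ₘ[μ] ℝ) t = 0 := h0t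
      linarith
    have hz' : μ (A n) = 0 := by simpa [ae_iff] using hz
    have := (hA n).2.1
    rw [hz'] at this
    norm_num at this
  have hfae : ∀ n, ((‖e n‖⁻¹ • e n : VarLp p μ) : Ω →ₘ[μ] ℝ) =ᵐ[μ]
      (A n).indicator fun _ => ‖e n‖⁻¹ := fun n => by
    filter_upwards [heae n, AEEqFun.coeFn_smul ‖e n‖⁻¹ (e n : Ω →ₘ[μ] ℝ)] with t ht hs
    refine Eq.trans hs ?_
    by_cases h : t ∈ A n <;> simp [ht, h]
  refine ⟨fun n => ‖e n‖⁻¹ • e n, fun n => norm_smul_inv_norm (𝕜 := ℝ) (he0 n), ?_, ?_⟩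
  · intro m n hmn
    filter_upwards [hfae m, hfae n] with t hm hn
    by_cases h : t ∈ A m
    · exact Or.inr (by rw [hn, Set.indicator_of_notMem (Set.disjoint_left.1 (hdisj hmn) h)])
    · exact Or.inl (by rw [hm, Set.indicator_of_notMem h])
  · set S := Submodule.span ℝ (Set.range fun n => ‖e n‖⁻¹ • e n) with hS
    have hstep : S ≤ (stepSubmodule μ A).comap (VarLp p μ).subtype := by
      rw [hS, Submodule.span_le]
      rintro _ ⟨n, rfl⟩
      refine ⟨fun k => if k = n then ‖e n‖⁻¹ else 0, ?_⟩
      filter_upwards [hfae n] with t ht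
      refine ⟨fun k hk => ht.trans ?_, fun h => ht.trans (Set.indicator_of_notMem (h n) _)⟩
      by_cases hkn : k = n
      · subst hkn; simp [hk]
      · simp [hkn, Set.disjoint_left.1 (hdisj hkn) hk]
    -- The inequality is a closed condition, so it is checked on the algebraic span only; limits
    -- need not be identified as step functions.
    have hle : ∀ x ∈ S.topologicalClosure, ‖x‖ ≤ ‖i x‖ := by
      have hcl : IsClosed {x : VarLp p μ | ‖x‖ ≤ ‖i x‖} :=
        isClosed_le continuous_norm i.continuous.norm
      intro x hx
      refine closure_minimal (fun y hy => ?_) hcl hx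
      exact luxemburg_le_of_mem_stepSubmodule hqp (fun n => (hA n).1) (fun n => (hA n).2.1)
        (hstep hy) (hincl y.2)
    have hanti : AntilipschitzWith 1 (i.comp S.topologicalClosure.subtypeL) :=
      AddMonoidHomClass.antilipschitz_of_bound _ fun x => by
        simpa using hle x x.2
    exact (hanti.isUniformEmbedding
      (i.comp S.topologicalClosure.subtypeL).uniformContinuous).isEmbedding
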